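/- Let $d\ge 0$ be an integer and let $|\cdot|$ be the Euclidean norm on $\mathbb{R}^d$; for $a>0$ write $B_a=\{x\in\mathbb{R}^d : |x|<a\}$. An additive process on $\mathbb{R}^d$ is a family $\{X_t\}_{t\ge 0}$ of $\mathbb{R}^d$-valued random variables on a probability space with $X_0=0$ almost surely, which is stochastically continuous, has independent increments, and almost surely has sample paths that are right-continuous in $t\ge 0$ and have left limits in $t>0$. A semi-Lévy process with period $p>0$ is an additive process such that $X_{t+p}-X_{s+p}$ and $X_t-X_s$ have the same law for all $s,t\ge 0$. A semi-random walk with period $k\in\{1,2,\dots\}$ is a sequence $\{S_n\}_{n\ge 0}$ of $\mathbb{R}^d$-valued random variables with $S_0=0$ almost surely and independent increments such that $S_{n+k}-S_{m+k}$ and $S_n-S_m$ have the same law for all integers $m,n\ge 0$. For $s\ge 0$, the process $\{X_t\}_{t\ge0}$ is called $s$-recurrent if $\liminf_{t\to\infty}|X_t-X_s|=0$ almost surely, recurrent if it is $s$-recurrent for every $s\ge 0$, and transient if $\lim_{t\to\infty}|X_t|=\infty$ almost surely. The same terms are used for sequences $\{S_n\}_{n\ge 0}$, with times in $\{0,1,2,\dots\}$.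 **Theorem.** Let $\{X_t\}_{t\ge 0}$ be a semi-Lévy process on $\mathbb{R}^d$ with period $p>0$. Then: (i) If $\{X_t\}$ is $0$-recurrent, then it is recurrent. (ii) $\{X_t\}$ is either recurrent or transient, and not both. (iii) $\{X_t\}$ is recurrent if and only if $\int_0^\infty P(X_t\in B_a)\,dt=\infty$ for every $a>0$. (iv) $\{X_t\}$ is recurrent if and only if, for every $a>0$, $\int_0^\infty \mathbf{1}_{B_a}(X_t)\,dt=\infty$ almost surely. (v) $\{X_t\}$ is transient if and only if $\int_0^\infty P(X_t\in B_a)\,dt<\infty$ for every $a>0$. (vi) $\{X_t\}$ is transient if and only if, for every $a>0$, $\int_0^\infty \mathbf{1}_{B_a}(X_t)\,dt<\infty$ almost surely. (vii) For every $h\in(0,\infty)\cap p\mathbb{Q}$, the sequence $\{X_{nh}\}_{n\ge 0}$ is a semi-random walk (with some period $k\in\{1,2,\dots\}$), and $\{X_t\}$ is recurrent if and only if $\{X_{nh}\}_{n\ge 0}$ is recurrent. -/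

import Mathlib

open MeasureTheory ProbabilityTheory Filter Topology
open scoped NNReal ENNReal

/-- An additive process on `ℝ^d`, defined on the probability space `(Ω, P)`: a family of random
vectors indexed by `t ≥ 0` which starts at `0` almost surely, is stochastically continuous, has
independent increments, and almost surely has right-continuous sample paths with left limits. -/
structure IsAdditiveProcess {Ω : Type*} [MeasurableSpace Ω] {d : ℕ}
    (X : ℝ≥0 → Ω → EuclideanSpace ℝ (Fin d)) (P : Measure Ω) : Prop where
  measurable : ∀ t, Measurable (X t)
  zero_ae : ∀ᵐ ω ∂P, X 0 ω = 0
  stochasticallyContinuous : ∀ t, TendstoInMeasure P X (𝓝 t) (X t)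
  indepIncrements : HasIndepIncrements X P
  rightContinuous : ∀ᵐ ω ∂P, ∀ t, ContinuousWithinAt (fun u ↦ X u ω) (Set.Ici t) t
  leftLimits : ∀ᵐ ω ∂P, ∀ t, 0 < t → ∃ l, Tendsto (fun u ↦ X u ω) (𝓝[<] t) (𝓝 l)

/-- A semi-Lévy process with period `p > 0`. -/
structure IsSemiLevyProcess {Ω : Type*} [MeasurableSpace Ω] {d : ℕ}
    (X : ℝ≥0 → Ω → EuclideanSpace ℝ (Fin d)) (p : ℝ≥0) (P : Measure Ω) : Prop
    extends IsAdditiveProcess X P where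
  period_pos : 0 < p
  identDistrib_shift : ∀ s t, IdentDistrib
    (fun ω ↦ X (t + p) ω - X (s + p) ω) (fun ω ↦ X t ω - X s ω) P P

/-- A semi-random walk with period `p ∈ {1, 2, …}`. -/
structure IsSemiRandomWalk {Ω : Type*} [MeasurableSpace Ω] {d : ℕ}
    (S : ℕ → Ω → EuclideanSpace ℝ (Fin d)) (p : ℕ) (P : Measure Ω) : Prop where
  measurable : ∀ n, Measurable (S n)
  period_pos : 0 < p
  zero_ae : ∀ᵐ ω ∂P, S 0 ω = 0
  indepIncrements : HasIndepIncrements S P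
  identDistrib_shift : ∀ m n, IdentDistrib
    (fun ω ↦ S (n + p) ω - S (m + p) ω) (fun ω ↦ S n ω - S m ω) P P

/-- `s`-recurrence, in continuous time (`T = ℝ≥0`) or discrete time (`T = ℕ`):
`liminf_{t → ∞} |X_t - X_s| = 0` almost surely. The liminf is taken in `[0, ∞]`, so that it is
`∞` on paths for which `|X_t - X_s|` tends to infinity. -/
def IsRecurrentFrom {Ω T : Type*} [MeasurableSpace Ω] [Preorder T] {d : ℕ} (s : T)
    (X : T → Ω → EuclideanSpace ℝ (Fin d)) (P : Measure Ω) : Prop :=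
  ∀ᵐ ω ∂P, liminf (fun t ↦ ‖X t ω - X s ω‖ₑ) atTop = 0

/-- Recurrence: `s`-recurrence for every time `s`. -/
def IsRecurrent {Ω T : Type*} [MeasurableSpace Ω] [Preorder T] {d : ℕ}
    (X : T → Ω → EuclideanSpace ℝ (Fin d)) (P : Measure Ω) : Prop :=
  ∀ s, IsRecurrentFrom s X P

/-- Transience: `lim_{t → ∞} |X_t| = ∞` almost surely. -/
def IsTransient {Ω T : Type*} [MeasurableSpace Ω] [Preorder T] {d : ℕ}
    (X : T → Ω → EuclideanSpace ℝ (Fin d)) (P : Measure Ω) : Prop :=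
  ∀ᵐ ω ∂P, Tendsto (fun t ↦ ‖X t ω‖) atTop atTop

/-- The time `∫_0^∞ 1_{B_a}(X_t(ω)) dt ∈ [0, ∞]` that the path `ω` spends in the open ball `B_a`
of radius `a` around the origin. -/
noncomputable def occupationTime {Ω : Type*} {d : ℕ}
    (X : ℝ≥0 → Ω → EuclideanSpace ℝ (Fin d)) (a : ℝ) (ω : Ω) : ℝ≥0∞ :=
  ∫⁻ t in Set.Ici (0 : ℝ), (Metric.ball (0 : EuclideanSpace ℝ (Fin d)) a).indicator (fun _ ↦ 1)
    (X t.toNNReal ω)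

/-- The integral `∫_0^∞ P(X_t ∈ B_a) dt ∈ [0, ∞]`. -/
noncomputable def potential {Ω : Type*} [MeasurableSpace Ω] {d : ℕ}
    (X : ℝ≥0 → Ω → EuclideanSpace ℝ (Fin d)) (P : Measure Ω) (a : ℝ) : ℝ≥0∞ :=
  ∫⁻ t in Set.Ici (0 : ℝ), P {ω | X t.toNNReal ω ∈ Metric.ball (0 : EuclideanSpace ℝ (Fin d)) a}

/-! Fix `s`. The increments of `X` along `s, s + p, s + 2p, …` are i.i.d., so this skeleton is a
random walk. The law of an increment over whole periods does not depend on `s`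
(`identDistrib_period`), so one quantity, `skeletonPotential`, controls the skeletons from all
starting times at once. For a random walk, the potentials of balls of positive radius are all
infinite or all finite (`walkPotential_lt_top_of_lt_top`).

If they are infinite, a last-exit argument makes every skeleton return near its starting point,
which gives recurrence. Since `X` stays in `B_a` for a short time after 0, Fubini over the starting
times in that interval makes the occupation time infinite almost surely.

If they are finite, a maximal inequality over one period bounds the probability of visiting `B_a`
during the period by twice the probability that `X` lies in a larger ball at its end. These bounds
are summable: Borel–Cantelli gives transience, and integration gives finite potentials.

The two cases exclude each other, so each equivalence is decided case by case
(`recurrent_or_transient`). For `k h = m p`, the skeleton of period `m p` is a subsequence of the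
walk `X_{nh}`. -/

/-! ### Independence of past and future. -/

section SigmaOf

variable {Ω E : Type*} [MeasurableSpace E]

/-- The σ-algebra generated by `ξ i` for `i` in `s`. -/
abbrev sigmaOf (ξ : ℕ → Ω → E) (s : Set ℕ) : MeasurableSpace Ω :=
  ⨆ i ∈ s, MeasurableSpace.comap (ξ i) inferInstance

lemma measurable_sigmaOf (ξ : ℕ → Ω → E) {s : Set ℕ} {i : ℕ} (hi : i ∈ s) :
    Measurable[sigmaOf ξ s] (ξ i) :=
  (comap_measurable (ξ i)).mono (le_iSup₂_of_le i hi le_rfl) le_rfl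

variable [MeasurableSpace Ω] {P : Measure Ω}

lemma sigmaOf_le {ξ : ℕ → Ω → E} (hm : ∀ i, Measurable (ξ i)) (s : Set ℕ) :
    sigmaOf ξ s ≤ ‹MeasurableSpace Ω› :=
  iSup₂_le fun i _ ↦ (hm i).comap_le

lemma measure_inter_sigmaOf {ξ : ℕ → Ω → E} (hm : ∀ i, Measurable (ξ i)) (hi : iIndepFun ξ P)
    (m : ℕ) {A B : Set Ω} (hA : MeasurableSet[sigmaOf ξ (Set.Iio m)] A)
    (hB : MeasurableSet[sigmaOf ξ (Set.Ici m)] B) : P (A ∩ B) = P A * P B := by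
  have h := indep_iSup_of_disjoint (fun i ↦ (hm i).comap_le) hi
    (S := Set.Iio m) (T := Set.Ici m)
    (Set.disjoint_left.2 fun _ h h' ↦ not_le.2 (Set.mem_Iio.1 h) (Set.mem_Ici.1 h'))
  exact (Indep_iff _ _ _).1 h A B hA hB

end SigmaOf

/-! ### Partial sums: first entries, the maximal inequality, the random walk dichotomy. -/

section PartialSums

variable {Ω E : Type*} [NormedAddCommGroup E]

/-- The partial sums `ξ 0 + ⋯ + ξ (n - 1)`. -/
def partialSum (ξ : ℕ → Ω → E) (n : ℕ) (ω : Ω) : E := ∑ i ∈ Finset.range n, ξ i ω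

lemma partialSum_sub {ξ : ℕ → Ω → E} {m n : ℕ} (h : m ≤ n) (ω : Ω) :
    partialSum ξ n ω - partialSum ξ m ω = ∑ i ∈ Finset.Ico m n, ξ i ω :=
  (Finset.sum_Ico_eq_sub (fun i ↦ ξ i ω) h).symm

lemma partialSum_add_sub (ξ : ℕ → Ω → E) (m n : ℕ) (ω : Ω) :
    partialSum ξ (m + n) ω - partialSum ξ m ω = partialSum (fun i ↦ ξ (m + i)) n ω := by
  rw [partialSum_sub (Nat.le_add_right m n), Finset.sum_Ico_eq_sum_range]
  simp [partialSum]

lemma partialSum_zero (ξ : ℕ → Ω → E) (ω : Ω) : partialSum ξ 0 ω = 0 := by simp [partialSum]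

/-- The event that `i` is the first index in `I` at which the partial sums are in `B`. -/
def firstEntry (ξ : ℕ → Ω → E) (I : Set ℕ) (B : Set E) (i : ℕ) : Set Ω :=
  {ω | i ∈ I ∧ partialSum ξ i ω ∈ B ∧ ∀ j < i, j ∈ I → partialSum ξ j ω ∉ B}

lemma pairwise_disjoint_firstEntry (ξ : ℕ → Ω → E) (I : Set ℕ) (B : Set E) :
    Pairwise (Function.onFun Disjoint (firstEntry ξ I B)) := by
  refine (pairwise_disjoint_on _).2 fun m n hmn ↦ Set.disjoint_left.2 fun ω h h' ↦ ?_
  exact h'.2.2 m hmn h.1 h.2.1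

lemma exists_mem_firstEntry {ξ : ℕ → Ω → E} {I : Set ℕ} {B : Set E} {ω : Ω} {n : ℕ}
    (hn : n ∈ I) (h : partialSum ξ n ω ∈ B) : ∃ i ≤ n, ω ∈ firstEntry ξ I B i := by
  classical
  have hex : ∃ n, n ∈ I ∧ partialSum ξ n ω ∈ B := ⟨n, hn, h⟩
  refine ⟨Nat.find hex, Nat.find_min' hex ⟨hn, h⟩, (Nat.find_spec hex).1,
    (Nat.find_spec hex).2, fun j hj hjI hjB ↦ Nat.find_min hex hj ⟨hjI, hjB⟩⟩

lemma measurableSet_firstEntry_of_forall {m : MeasurableSpace Ω} {ξ : ℕ → Ω → E} (I : Set ℕ)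
    {B : Set E} {i : ℕ} (h : ∀ j ≤ i, MeasurableSet (partialSum ξ j ⁻¹' B)) :
    MeasurableSet (firstEntry ξ I B i) := by
  by_cases hi : i ∈ I
  · have : firstEntry ξ I B i = (partialSum ξ i ⁻¹' B) ∩
        ⋂ j ∈ {j | j < i ∧ j ∈ I}, (partialSum ξ j ⁻¹' B)ᶜ := by
      ext ω
      simp [firstEntry, hi]
    rw [this]
    exact (h i le_rfl).inter <| MeasurableSet.biInter (Set.to_countable _)
      fun j hj ↦ (h j hj.1.le).compl
  · have : firstEntry ξ I B i = ∅ := by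
      ext ω
      simp [firstEntry, hi]
    rw [this]
    exact MeasurableSet.empty

/-- One strictly later return near each `x m` is enough: chaining returns with halved tolerances
pushes the time past any `N`, so no zero-one law is needed. -/
lemma forall_exists_norm_lt_of_returns {x : ℕ → E} (h0 : x 0 = 0)
    (h : ∀ m, ∀ ε : ℝ, 0 < ε → ∃ n, 0 < n ∧ ‖x (m + n) - x m‖ < ε) (N : ℕ) :
    ∀ ε : ℝ, 0 < ε → ∃ n, N ≤ n ∧ ‖x n‖ < ε := by
  induction N with
  | zero => exact fun ε hε ↦ ⟨0, le_rfl, by simpa [h0]⟩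
  | succ N ih =>
    intro ε hε
    obtain ⟨m, hNm, hm⟩ := ih (ε / 2) (by positivity)
    obtain ⟨n, hn, hmn⟩ := h m (ε / 2) (by positivity)
    refine ⟨m + n, by omega, ?_⟩
    have := norm_add_le (x (m + n) - x m) (x m)
    rw [sub_add_cancel] at this
    linarith

/-- The potential `∑ₙ P(|Sₙ| < a)` of the ball of radius `a` for the partial sums of `ξ`. -/
noncomputable def walkPotential [MeasurableSpace Ω] (ξ : ℕ → Ω → E) (P : Measure Ω) (a : ℝ) :
    ℝ≥0∞ :=
  ∑' n, P {ω | ‖partialSum ξ n ω‖ < a}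

variable [MeasurableSpace E]

lemma measurableSet_norm_lt [OpensMeasurableSpace E] {m : MeasurableSpace Ω} {f : Ω → E}
    (hf : Measurable f) (a : ℝ) : MeasurableSet {ω | ‖f ω‖ < a} :=
  hf.norm measurableSet_Iio

variable [BorelSpace E] [SecondCountableTopology E]

lemma measurable_partialSum_sigmaOf (ξ : ℕ → Ω → E) {m n : ℕ} (h : n ≤ m) :
    Measurable[sigmaOf ξ (Set.Iio m)] (partialSum ξ n) := by
  refine Finset.measurable_fun_sum _ fun i hi ↦ measurable_sigmaOf ξ ?_
  exact (Finset.mem_range.1 hi).trans_le h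

lemma measurable_partialSum_sub_sigmaOf (ξ : ℕ → Ω → E) {m n : ℕ} (h : m ≤ n) :
    Measurable[sigmaOf ξ (Set.Ici m)] (fun ω ↦ partialSum ξ n ω - partialSum ξ m ω) := by
  simp_rw [partialSum_sub h]
  exact Finset.measurable_fun_sum _ fun i hi ↦ measurable_sigmaOf ξ (Finset.mem_Ico.1 hi).1

lemma measurableSet_firstEntry (ξ : ℕ → Ω → E) (I : Set ℕ) {B : Set E} (hB : MeasurableSet B)
    (i : ℕ) : MeasurableSet[sigmaOf ξ (Set.Iio i)] (firstEntry ξ I B i) :=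
  measurableSet_firstEntry_of_forall I fun _ hj ↦ measurable_partialSum_sigmaOf ξ hj hB

variable [MeasurableSpace Ω] {P : Measure Ω}

/-- A maximal inequality for sums of independent random vectors. -/
lemma measure_exists_partialSum_mem_ball_le {ξ : ℕ → Ω → E} (hm : ∀ i, Measurable (ξ i))
    (hi : iIndepFun ξ P) {I : Set ℕ} {N : ℕ} (hI : ∀ i ∈ I, i ≤ N) {a b : ℝ}
    (hb : ∀ i ∈ I, 2⁻¹ ≤ P {ω | ‖partialSum ξ N ω - partialSum ξ i ω‖ < b}) :
    P {ω | ∃ i ∈ I, ‖partialSum ξ i ω‖ < a} ≤ 2 * P {ω | ‖partialSum ξ N ω‖ < a + b} := by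
  set T := firstEntry ξ I (Metric.ball 0 a)
  set D : ℕ → Set Ω := fun i ↦ {ω | ‖partialSum ξ N ω - partialSum ξ i ω‖ < b}
  have hball : MeasurableSet (Metric.ball (0 : E) a) := measurableSet_ball
  have hD : ∀ i ≤ N, MeasurableSet[sigmaOf ξ (Set.Ici i)] (D i) := fun i hiN ↦
    measurableSet_norm_lt (measurable_partialSum_sub_sigmaOf ξ hiN) b
  -- First entry at `i` depends on the past of `i` and `D i` on its future; independence and `P (D
  -- i) ≥ 1/2` give the factor 2.
  have hT : ∀ i, P (T i) ≤ 2 * P (T i ∩ D i) := by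
    intro i
    by_cases hiI : i ∈ I
    · rw [measure_inter_sigmaOf hm hi i (measurableSet_firstEntry ξ I hball i)
        (hD i (hI i hiI))]
      calc P (T i) = 2 * (P (T i) * 2⁻¹) := by
            rw [mul_comm (P (T i)), ← mul_assoc, ENNReal.mul_inv_cancel (by simp) (by simp),
              one_mul]
        _ ≤ 2 * (P (T i) * P (D i)) := by gcongr; exact hb i hiI
    · have : T i = ∅ := by
        ext ω
        simp [T, firstEntry, hiI]
      simp [this]
  calc P {ω | ∃ i ∈ I, ‖partialSum ξ i ω‖ < a}
      ≤ P (⋃ i ∈ Finset.range (N + 1), T i) := by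
        refine measure_mono ?_
        rintro ω ⟨i, hiI, h⟩
        obtain ⟨j, hj, hjT⟩ := exists_mem_firstEntry (ξ := ξ) (B := Metric.ball 0 a) (ω := ω) hiI
          (by simpa using h)
        simp only [Set.mem_iUnion, Finset.mem_range]
        exact ⟨j, Nat.lt_succ_of_le (hj.trans (hI i hiI)), hjT⟩
    _ ≤ ∑ i ∈ Finset.range (N + 1), P (T i) := measure_biUnion_finset_le _ _
    _ ≤ ∑ i ∈ Finset.range (N + 1), 2 * P (T i ∩ D i) := Finset.sum_le_sum fun i _ ↦ hT i
    _ = 2 * P (⋃ i ∈ Finset.range (N + 1), T i ∩ D i) := by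
        rw [← Finset.mul_sum, measure_biUnion_finset]
        · exact fun i _ j _ hij ↦ (pairwise_disjoint_firstEntry ξ I _ hij).mono
            Set.inter_subset_left Set.inter_subset_left
        · intro i hiN
          refine (sigmaOf_le hm _ _ (measurableSet_firstEntry ξ I hball i)).inter
            (sigmaOf_le hm _ _ (hD i ?_))
          exact Nat.le_of_lt_succ (Finset.mem_range.1 hiN)
    _ ≤ 2 * P {ω | ‖partialSum ξ N ω‖ < a + b} := by
        gcongr
        refine Set.iUnion₂_subset fun i _ ω h ↦ ?_
        have h1 : ‖partialSum ξ i ω‖ < a := by simpa using h.1.2.1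
        have h2 : ‖partialSum ξ N ω - partialSum ξ i ω‖ < b := h.2
        have := norm_add_le (partialSum ξ i ω) (partialSum ξ N ω - partialSum ξ i ω)
        rw [add_sub_cancel] at this
        exact this.trans_lt (add_lt_add h1 h2)

/-! ### Random walks -/

variable {ξ : ℕ → Ω → E}

lemma identDistrib_partialSum_add_sub
    (hi : iIndepFun ξ P) (hd : ∀ i, IdentDistrib (ξ i) (ξ 0) P P) (m : ℕ) :
    IdentDistrib (fun ω n ↦ partialSum ξ (m + n) ω - partialSum ξ m ω)
      (fun ω n ↦ partialSum ξ n ω) P P := by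
  have h : IdentDistrib (fun ω i ↦ ξ (m + i) ω) (fun ω i ↦ ξ i ω) P P :=
    IdentDistrib.pi (fun i ↦ (hd (m + i)).trans (hd i).symm)
      (hi.precomp (add_right_injective m)) hi
  have hu : Measurable (fun (x : ℕ → E) (n : ℕ) ↦ ∑ i ∈ Finset.range n, x i) :=
    measurable_pi_lambda _ fun n ↦ Finset.measurable_fun_sum _ fun i _ ↦ measurable_pi_apply i
  simp_rw [partialSum_add_sub]
  exact h.comp hu

lemma measure_norm_partialSum_add_sub (hi : iIndepFun ξ P)
    (hd : ∀ i, IdentDistrib (ξ i) (ξ 0) P P) (m n : ℕ) (a : ℝ) :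
    P {ω | ‖partialSum ξ (m + n) ω - partialSum ξ m ω‖ < a} = P {ω | ‖partialSum ξ n ω‖ < a} :=
  (identDistrib_partialSum_add_sub hi hd m).measure_mem_eq
    (s := {x | ‖x n‖ < a}) ((measurable_pi_apply n).norm measurableSet_Iio)

/-- Decompose at the first entry time `m` into the ball: every later visit is a displacement of less
than `2 * r` from the entry point, the displacement is independent of the past and distributed as
the walk itself, and the events `T m` have total mass at most 1. -/
lemma tsum_measure_partialSum_mem_ball_le [IsProbabilityMeasure P] (hm : ∀ i, Measurable (ξ i))
    (hi : iIndepFun ξ P) (hd : ∀ i, IdentDistrib (ξ i) (ξ 0) P P) (x : E) (r : ℝ) :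
    ∑' n, P {ω | partialSum ξ n ω ∈ Metric.ball x r} ≤ walkPotential ξ P (2 * r) := by
  set B := Metric.ball x r
  set T := firstEntry ξ Set.univ B
  have hB : MeasurableSet B := measurableSet_ball
  have hTm : ∀ i, MeasurableSet (T i) := fun i ↦
    sigmaOf_le hm _ _ (measurableSet_firstEntry ξ _ hB i)
  have key : ∀ n, P {ω | partialSum ξ n ω ∈ B} ≤
      ∑' m, if m ≤ n then P (T m) * P {ω | ‖partialSum ξ (n - m) ω‖ < 2 * r} else 0 := by
    intro n
    set F : ℕ → Set Ω := fun m ↦ if m ≤ n then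
      T m ∩ {ω | ‖partialSum ξ n ω - partialSum ξ m ω‖ < 2 * r} else ∅
    calc P {ω | partialSum ξ n ω ∈ B} ≤ P (⋃ m, F m) := by
          refine measure_mono fun ω h ↦ ?_
          obtain ⟨m, hmn, hT⟩ := exists_mem_firstEntry (Set.mem_univ n) h
          refine Set.mem_iUnion.2 ⟨m, ?_⟩
          simp only [F, hmn, if_true]
          refine ⟨hT, ?_⟩
          have h1 : dist (partialSum ξ n ω) x < r := h
          have h2 : dist (partialSum ξ m ω) x < r := hT.2.1
          have h3 := dist_triangle_right (partialSum ξ n ω) (partialSum ξ m ω) x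
          rw [dist_eq_norm] at h3
          change ‖partialSum ξ n ω - partialSum ξ m ω‖ < 2 * r
          linarith
      _ ≤ ∑' m, P (F m) := measure_iUnion_le _
      _ = _ := by
          refine tsum_congr fun m ↦ ?_
          by_cases hmn : m ≤ n
          · simp only [F, hmn, if_true]
            rw [measure_inter_sigmaOf hm hi m (measurableSet_firstEntry ξ _ hB m)
              (measurableSet_norm_lt (measurable_partialSum_sub_sigmaOf ξ hmn) _)]
            congr 1
            obtain ⟨k, rfl⟩ := Nat.exists_eq_add_of_le hmn
            rw [Nat.add_sub_cancel_left]
            exact measure_norm_partialSum_add_sub hi hd m k _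
          · simp [F, hmn]
  calc ∑' n, P {ω | partialSum ξ n ω ∈ B}
      ≤ ∑' n, ∑' m, if m ≤ n then P (T m) * P {ω | ‖partialSum ξ (n - m) ω‖ < 2 * r} else 0 :=
        ENNReal.tsum_le_tsum key
    _ = ∑' m, ∑' n, if m ≤ n then P (T m) * P {ω | ‖partialSum ξ (n - m) ω‖ < 2 * r} else 0 :=
        ENNReal.tsum_comm
    _ = ∑' m, P (T m) * walkPotential ξ P (2 * r) := by
        refine tsum_congr fun m ↦ ?_
        rw [walkPotential, ← ENNReal.tsum_mul_left, ← (add_right_injective m).tsum_eq]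
        · simp
        · intro n hn
          have : m ≤ n := by
            by_contra h
            simp [h] at hn
          exact ⟨n - m, by simp; omega⟩
    _ = P (⋃ m, T m) * walkPotential ξ P (2 * r) := by
        rw [ENNReal.tsum_mul_right, measure_iUnion (pairwise_disjoint_firstEntry ξ _ _) hTm]
    _ ≤ 1 * walkPotential ξ P (2 * r) := by gcongr; exact prob_le_one
    _ = _ := one_mul _

/-- Cover the ball of radius `a` by finitely many balls of radius `r / 2`; each has expected number
of visits at most `walkPotential ξ P r`. -/
lemma walkPotential_lt_top_of_lt_top [IsProbabilityMeasure P] [ProperSpace E]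
    (hm : ∀ i, Measurable (ξ i)) (hi : iIndepFun ξ P)
    (hd : ∀ i, IdentDistrib (ξ i) (ξ 0) P P) {r : ℝ} (hr : 0 < r)
    (h : walkPotential ξ P r < ∞) (a : ℝ) : walkPotential ξ P a < ∞ := by
  obtain ⟨t, -, ht⟩ := (isCompact_closedBall (0 : E) a).elim_nhds_subcover
    (fun x ↦ Metric.ball x (r / 2)) fun x _ ↦ Metric.ball_mem_nhds x (by positivity)
  calc walkPotential ξ P a
      ≤ ∑' n, ∑ x ∈ t, P {ω | partialSum ξ n ω ∈ Metric.ball x (r / 2)} := by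
        refine ENNReal.tsum_le_tsum fun n ↦ (measure_mono fun ω hω ↦ ?_).trans
          (measure_biUnion_finset_le t fun x ↦ {ω | partialSum ξ n ω ∈ Metric.ball x (r / 2)})
        have : partialSum ξ n ω ∈ Metric.closedBall (0 : E) a := by
          simpa using le_of_lt (show ‖partialSum ξ n ω‖ < a from hω)
        simpa using ht this
    _ = ∑ x ∈ t, ∑' n, P {ω | partialSum ξ n ω ∈ Metric.ball x (r / 2)} :=
        Summable.tsum_finsetSum fun _ _ ↦ ENNReal.summable
    _ ≤ ∑ _x ∈ t, walkPotential ξ P r := by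
        refine Finset.sum_le_sum fun x _ ↦ ?_
        have := tsum_measure_partialSum_mem_ball_le hm hi hd x (r / 2)
        rwa [mul_div_cancel₀ r two_ne_zero] at this
    _ < ∞ := ENNReal.sum_lt_top.2 fun _ _ ↦ h

/-- A random walk whose potentials are all infinite returns to every neighbourhood of `0`. -/
lemma ae_exists_norm_partialSum_lt_of_walkPotential_eq_top [IsProbabilityMeasure P]
    (hm : ∀ i, Measurable (ξ i)) (hi : iIndepFun ξ P)
    (hd : ∀ i, IdentDistrib (ξ i) (ξ 0) P P) {ε : ℝ} (h : walkPotential ξ P ε = ∞) :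
    ∀ᵐ ω ∂P, ∃ n, 0 < n ∧ ‖partialSum ξ n ω‖ < 2 * ε := by
  set R : Set (ℕ → E) := {x | ∀ n, 0 < n → 2 * ε ≤ ‖x n‖}
  have hR : MeasurableSet R := by
    have : R = ⋂ n, ⋂ (_ : 0 < n), {x : ℕ → E | 2 * ε ≤ ‖x n‖} := by
      ext x
      simp [R]
    rw [this]
    exact MeasurableSet.iInter fun n ↦ MeasurableSet.iInter fun _ ↦
      (measurable_pi_apply n).norm measurableSet_Ici
  set ρ := P {ω | (fun n ↦ partialSum ξ n ω) ∈ R}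
  -- A last-exit decomposition: `L m` says that the walk is in the `ε`-ball at time `m` and then
  -- stays at distance at least `2 * ε` from its position. Two points of the `ε`-ball are closer
  -- than that, so the `L m` are disjoint and `walkPotential ξ P ε * ρ ≤ 1`.
  set L : ℕ → Set Ω := fun m ↦ {ω | ‖partialSum ξ m ω‖ < ε} ∩
    {ω | (fun n ↦ partialSum ξ (m + n) ω - partialSum ξ m ω) ∈ R}
  have hpast : ∀ m, MeasurableSet[sigmaOf ξ (Set.Iio m)] {ω | ‖partialSum ξ m ω‖ < ε} :=
    fun m ↦ measurableSet_norm_lt (measurable_partialSum_sigmaOf ξ le_rfl) ε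
  have hfut : ∀ m, MeasurableSet[sigmaOf ξ (Set.Ici m)]
      {ω | (fun n ↦ partialSum ξ (m + n) ω - partialSum ξ m ω) ∈ R} := fun m ↦
    (@measurable_pi_lambda _ _ _ (sigmaOf ξ (Set.Ici m)) _ _ fun n ↦
      measurable_partialSum_sub_sigmaOf ξ (Nat.le_add_right m n)) hR
  have hL : ∀ m, P (L m) = P {ω | ‖partialSum ξ m ω‖ < ε} * ρ := fun m ↦ by
    rw [measure_inter_sigmaOf hm hi m (hpast m) (hfut m)]
    congr 1
    exact (identDistrib_partialSum_add_sub hi hd m).measure_mem_eq hR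
  have hdisj : Pairwise (Function.onFun Disjoint L) := by
    refine (pairwise_disjoint_on _).2 fun m n hmn ↦ Set.disjoint_left.2 fun ω h1 h2 ↦ ?_
    have h3 := h1.2 (n - m) (Nat.sub_pos_of_lt hmn)
    simp only [Nat.add_sub_cancel' hmn.le] at h3
    have h4 : ‖partialSum ξ m ω‖ < ε := h1.1
    have h5 : ‖partialSum ξ n ω‖ < ε := h2.1
    have := norm_sub_le (partialSum ξ n ω) (partialSum ξ m ω)
    linarith
  have hsum : walkPotential ξ P ε * ρ ≤ 1 := by
    rw [walkPotential, ← ENNReal.tsum_mul_right]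
    simp_rw [← hL]
    rw [← measure_iUnion hdisj fun m ↦
      (sigmaOf_le hm _ _ (hpast m)).inter (sigmaOf_le hm _ _ (hfut m))]
    exact prob_le_one
  have hρ : ρ = 0 := by
    by_contra hne
    rw [h, ENNReal.top_mul hne] at hsum
    simp at hsum
  rw [ae_iff]
  convert hρ using 2
  ext ω
  simp [R]

/-- A random walk whose potentials are all infinite is recurrent. -/
lemma ae_forall_exists_norm_partialSum_lt [IsProbabilityMeasure P] (hm : ∀ i, Measurable (ξ i))
    (hi : iIndepFun ξ P) (hd : ∀ i, IdentDistrib (ξ i) (ξ 0) P P)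
    (h : ∀ a, 0 < a → walkPotential ξ P a = ∞) :
    ∀ᵐ ω ∂P, ∀ N, ∀ ε : ℝ, 0 < ε → ∃ n, N ≤ n ∧ ‖partialSum ξ n ω‖ < ε := by
  have key : ∀ m j : ℕ, ∀ᵐ ω ∂P, ∃ n, 0 < n ∧
      ‖partialSum ξ (m + n) ω - partialSum ξ m ω‖ < 2 * (1 / (j + 1 : ℝ)) := by
    intro m j
    set Q : Set (ℕ → E) := {x | ∃ n, 0 < n ∧ ‖x n‖ < 2 * (1 / (j + 1 : ℝ))}
    have hQ : MeasurableSet Q := by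
      have : Q = ⋃ n, ⋃ (_ : 0 < n), {x : ℕ → E | ‖x n‖ < 2 * (1 / (j + 1 : ℝ))} := by
        ext x
        simp [Q]
      rw [this]
      exact MeasurableSet.iUnion fun n ↦ MeasurableSet.iUnion fun _ ↦
        (measurable_pi_apply n).norm measurableSet_Iio
    exact (identDistrib_partialSum_add_sub hi hd m).symm.ae_mem_snd hQ
      (ae_exists_norm_partialSum_lt_of_walkPotential_eq_top hm hi hd (h _ (by positivity)))
  filter_upwards [ae_all_iff.2 fun m ↦ ae_all_iff.2 (key m)] with ω hω N
  refine forall_exists_norm_lt_of_returns (x := fun n ↦ partialSum ξ n ω)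
    (partialSum_zero ξ ω) (fun m ε hε ↦ ?_) N
  obtain ⟨j, hj⟩ := exists_nat_one_div_lt (half_pos hε)
  obtain ⟨n, hn, hn'⟩ := hω m j
  exact ⟨n, hn, hn'.trans (by linarith)⟩

end PartialSums

/-! ### Liminf criteria along sequences of times. -/

section Liminf

variable {E T : Type*} [NormedAddCommGroup E] [Preorder T]

lemma liminf_enorm_eq_zero_of_subseq {x : T → E} {u : ℕ → T} (hu : Tendsto u atTop atTop)
    (h : ∀ N, ∀ ε : ℝ, 0 < ε → ∃ n, N ≤ n ∧ ‖x (u n)‖ < ε) :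
    liminf (fun t ↦ ‖x t‖ₑ) atTop = 0 := by
  refine le_antisymm (le_of_forall_gt_imp_ge_of_dense fun ε hε ↦ ?_) zero_le
  refine liminf_le_of_frequently_le' (hu.frequently ?_)
  refine frequently_atTop.2 fun N ↦ ?_
  obtain ⟨r, hr0, hr⟩ := ENNReal.lt_iff_exists_real_btwn.1 hε
  obtain ⟨n, hn, hlt⟩ := h N r (by simpa using hr.1)
  refine ⟨n, hn, le_trans ?_ hr.2.le⟩
  rw [← ofReal_norm]
  exact ENNReal.ofReal_le_ofReal hlt.le

lemma liminf_enorm_eq_zero_of_comp {x : T → E} {u : ℕ → T} (hu : Tendsto u atTop atTop)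
    (h : liminf (fun n ↦ ‖x (u n)‖ₑ) atTop = 0) : liminf (fun t ↦ ‖x t‖ₑ) atTop = 0 :=
  le_antisymm ((liminf_le_liminf_of_le (g := map u atTop) (u := fun t ↦ ‖x t‖ₑ) hu).trans h.le)
    zero_le

lemma liminf_enorm_eq_top [IsDirectedOrder T] [Nonempty T] {x : T → E}
    (h : Tendsto (fun t ↦ ‖x t‖) atTop atTop) : liminf (fun t ↦ ‖x t‖ₑ) atTop = ∞ := by
  refine Tendsto.liminf_eq ?_
  simp_rw [← ofReal_norm]
  exact ENNReal.tendsto_ofReal_atTop.comp h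

end Liminf

/-! ### The random walk skeletons of a semi-Lévy process. -/

section SemiLevy

variable {Ω : Type*} {d : ℕ}

/-- The increments of `X` along `s, s + p, s + 2 p, …`. -/
def skeletonIncrement (X : ℝ≥0 → Ω → EuclideanSpace ℝ (Fin d)) (p s : ℝ≥0) (i : ℕ)
    (ω : Ω) : EuclideanSpace ℝ (Fin d) :=
  X (s + (i + 1 : ℕ) * p) ω - X (s + i * p) ω

lemma partialSum_skeletonIncrement (X : ℝ≥0 → Ω → EuclideanSpace ℝ (Fin d)) (p s : ℝ≥0)
    (n : ℕ) (ω : Ω) : partialSum (skeletonIncrement X p s) n ω = X (s + n * p) ω - X s ω := by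
  simp only [partialSum, skeletonIncrement]
  rw [Finset.sum_range_sub (fun i : ℕ ↦ X (s + i * p) ω)]
  simp

/-- The expected number of visits of `X` to the ball of radius `a` at times in `p ℕ`. -/
noncomputable def skeletonPotential (X : ℝ≥0 → Ω → EuclideanSpace ℝ (Fin d)) (p : ℝ≥0)
    [MeasurableSpace Ω] (P : Measure Ω) (a : ℝ) : ℝ≥0∞ :=
  ∑' n : ℕ, P {ω | ‖X (n * p) ω‖ < a}

variable [MeasurableSpace Ω] {P : Measure Ω}
  {X : ℝ≥0 → Ω → EuclideanSpace ℝ (Fin d)} {p : ℝ≥0}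

namespace IsSemiLevyProcess

lemma identDistrib_shift_nat (hX : IsSemiLevyProcess X p P) (n : ℕ) (s t : ℝ≥0) :
    IdentDistrib (fun ω ↦ X (t + n * p) ω - X (s + n * p) ω) (fun ω ↦ X t ω - X s ω) P P := by
  induction n with
  | zero =>
    have h : AEMeasurable (fun ω ↦ X t ω - X s ω) P :=
      ((hX.measurable t).sub (hX.measurable s)).aemeasurable
    simpa using IdentDistrib.refl h
  | succ n ih =>
    have h := hX.identDistrib_shift (s + n * p) (t + n * p)
    have e : ∀ r : ℝ≥0, r + (n + 1 : ℕ) * p = r + n * p + p := fun r ↦ by push_cast; ring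
    simp_rw [e]
    exact h.trans ih

lemma nat_mul (hX : IsSemiLevyProcess X p P) {n : ℕ} (hn : 0 < n) :
    IsSemiLevyProcess X (n * p) P where
  toIsAdditiveProcess := hX.toIsAdditiveProcess
  period_pos := mul_pos (by exact_mod_cast hn) hX.period_pos
  identDistrib_shift := hX.identDistrib_shift_nat n

/-- The increment over any interval of length `p` has the law of the increment over `[0, p]`. -/
lemma identDistrib_period [IsProbabilityMeasure P] (hX : IsSemiLevyProcess X p P) (s : ℝ≥0) :
    IdentDistrib (fun ω ↦ X (s + p) ω - X s ω) (fun ω ↦ X p ω - X 0 ω) P P := by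
  -- Split at `p`: `X (s + p) - X p` has the law of `X s - X 0`, and both are independent of `X p -
  -- X s`, so adding `X p - X s` yields equal laws.
  have small : ∀ s ≤ p,
      IdentDistrib (fun ω ↦ X (s + p) ω - X s ω) (fun ω ↦ X p ω - X 0 ω) P P := by
    intro s hs
    have h1 : IdentDistrib (fun ω ↦ X (s + p) ω - X p ω) (fun ω ↦ X s ω - X 0 ω) P P := by
      simpa using hX.identDistrib_shift 0 s
    have h2 : IdentDistrib (X p - X s) (X p - X s) P P :=
      IdentDistrib.refl ((hX.measurable p).sub (hX.measurable s)).aemeasurable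
    have i1 : (X (s + p) - X p) ⟂ᵢ[P] (X p - X s) :=
      (hX.indepIncrements.indepFun_sub_sub hs le_add_self).symm
    have i2 : (X s - X 0) ⟂ᵢ[P] (X p - X s) :=
      hX.indepIncrements.indepFun_sub_sub zero_le hs
    have := (h1.prodMk h2 i1 i2).comp (measurable_fst.add measurable_snd)
    simpa [Function.comp_def] using this
  have large : ∀ n : ℕ, ∀ s ≤ (n + 1) * p,
      IdentDistrib (fun ω ↦ X (s + p) ω - X s ω) (fun ω ↦ X p ω - X 0 ω) P P := by
    intro n
    induction n with
    | zero => simpa using small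
    | succ n ih =>
      intro s hs
      obtain h | h := le_total s p
      · exact small s h
      · obtain ⟨r, rfl⟩ := (⟨s - p, (tsub_add_cancel_of_le h).symm⟩ : ∃ r, s = r + p)
        refine (hX.identDistrib_shift r (r + p)).trans (ih r ?_)
        push_cast at hs
        rw [add_one_mul] at hs
        exact le_of_add_le_add_right hs
  obtain ⟨n, hn⟩ := exists_nat_ge (s / p)
  refine large n s ?_
  rw [div_le_iff₀ hX.period_pos] at hn
  exact hn.trans (by gcongr; simp)

lemma measurable_skeletonIncrement (hX : IsSemiLevyProcess X p P) (s : ℝ≥0) (i : ℕ) :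
    Measurable (skeletonIncrement X p s i) :=
  (hX.measurable _).sub (hX.measurable _)

lemma iIndepFun_skeletonIncrement (hX : IsSemiLevyProcess X p P) (s : ℝ≥0) :
    iIndepFun (skeletonIncrement X p s) P :=
  hX.indepIncrements.nat (t := fun i : ℕ ↦ s + i * p) fun i j hij ↦ by dsimp only; gcongr

lemma identDistrib_skeletonIncrement (hX : IsSemiLevyProcess X p P) (s : ℝ≥0) (i : ℕ) :
    IdentDistrib (skeletonIncrement X p s i) (skeletonIncrement X p s 0) P P := by
  have := hX.identDistrib_shift_nat i s (s + p)
  have e : s + p + i * p = s + (i + 1 : ℕ) * p := by push_cast; ring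
  rw [e] at this
  unfold skeletonIncrement
  simpa using this

/-- The right side is free of `s`, which is why 0-recurrence forces recurrence from every time.
Apply `identDistrib_period` to the period `n * p`; `n = 0` is not a period and is treated
separately. -/
lemma walkPotential_skeletonIncrement [IsProbabilityMeasure P] (hX : IsSemiLevyProcess X p P)
    (s : ℝ≥0) (a : ℝ) : walkPotential (skeletonIncrement X p s) P a = skeletonPotential X p P a := by
  refine tsum_congr fun n ↦ ?_
  simp_rw [partialSum_skeletonIncrement]
  have h0 : P {ω | ‖X (n * p) ω - X 0 ω‖ < a} = P {ω | ‖X (n * p) ω‖ < a} := by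
    refine measure_congr ?_
    filter_upwards [hX.zero_ae] with ω hω
    change (‖X (n * p) ω - X 0 ω‖ < a) = (‖X (n * p) ω‖ < a)
    rw [hω, sub_zero]
  rw [← h0]
  obtain rfl | hn := n.eq_zero_or_pos
  · simp
  · exact ((hX.nat_mul hn).identDistrib_period s).measure_mem_eq
      (s := {x | ‖x‖ < a}) (measurable_norm measurableSet_Iio)

lemma skeletonPotential_eq_top_or_lt_top [IsProbabilityMeasure P]
    (hX : IsSemiLevyProcess X p P) :
    (∀ a : ℝ, 0 < a → skeletonPotential X p P a = ∞) ∨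
      ∀ a : ℝ, skeletonPotential X p P a < ∞ := by
  simp_rw [← hX.walkPotential_skeletonIncrement 0]
  by_contra! h
  obtain ⟨⟨r, hr, hr'⟩, a, ha⟩ := h
  exact (walkPotential_lt_top_of_lt_top (hX.measurable_skeletonIncrement 0)
    (hX.iIndepFun_skeletonIncrement 0) (hX.identDistrib_skeletonIncrement 0) hr
    (lt_top_iff_ne_top.2 hr') a).ne (top_le_iff.1 ha)

lemma ae_forall_exists_norm_sub_lt [IsProbabilityMeasure P] (hX : IsSemiLevyProcess X p P)
    (h : ∀ a : ℝ, 0 < a → skeletonPotential X p P a = ∞) (s : ℝ≥0) :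
    ∀ᵐ ω ∂P, ∀ N, ∀ ε : ℝ, 0 < ε → ∃ n : ℕ, N ≤ n ∧ ‖X (s + n * p) ω - X s ω‖ < ε := by
  simp_rw [← hX.walkPotential_skeletonIncrement s] at h
  simp_rw [← partialSum_skeletonIncrement]
  exact ae_forall_exists_norm_partialSum_lt (hX.measurable_skeletonIncrement s)
    (hX.iIndepFun_skeletonIncrement s) (hX.identDistrib_skeletonIncrement s) h

lemma tendsto_add_nat_mul_period (hX : IsSemiLevyProcess X p P) (s : ℝ≥0) :
    Tendsto (fun n : ℕ ↦ s + n * p) atTop atTop :=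
  tendsto_atTop_mono (fun _ ↦ le_add_self)
    (tendsto_natCast_atTop_atTop.atTop_mul_const hX.period_pos)

lemma isRecurrent_of_skeletonPotential_eq_top [IsProbabilityMeasure P]
    (hX : IsSemiLevyProcess X p P)
    (h : ∀ a : ℝ, 0 < a → skeletonPotential X p P a = ∞) : IsRecurrent X P := by
  intro s
  filter_upwards [hX.ae_forall_exists_norm_sub_lt h s] with ω hω
  exact liminf_enorm_eq_zero_of_subseq (x := fun t ↦ X t ω - X s ω)
    (hX.tendsto_add_nat_mul_period s) hω

lemma not_isRecurrentFrom_zero_and_isTransient [IsProbabilityMeasure P]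
    (hX : IsSemiLevyProcess X p P) : ¬ (IsRecurrentFrom 0 X P ∧ IsTransient X P) := by
  rintro ⟨h, h'⟩
  obtain ⟨ω, h0, h1, h2⟩ := (hX.zero_ae.and (h.and h')).exists
  simp only [h0, sub_zero] at h1
  exact ENNReal.top_ne_zero ((liminf_enorm_eq_top h2).symm.trans h1)

end IsSemiLevyProcess

end SemiLevy

/-! ### A maximal inequality in continuous time, and transience. -/

section Transience

variable {Ω : Type*} [MeasurableSpace Ω] {P : Measure Ω} {d : ℕ}
  {X : ℝ≥0 → Ω → EuclideanSpace ℝ (Fin d)} {p : ℝ≥0}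

lemma exists_measure_le_norm_le {E : Type*} [NormedAddCommGroup E] [MeasurableSpace E]
    [BorelSpace E] [IsFiniteMeasure P] {f : Ω → E} (hf : Measurable f) {ε : ℝ≥0∞} (hε : 0 < ε) :
    ∃ b : ℝ, P {ω | b ≤ ‖f ω‖} ≤ ε := by
  have h := tendsto_measure_iInter_atTop (μ := P) (s := fun n : ℕ ↦ {ω | (n : ℝ) ≤ ‖f ω‖})
    (fun n ↦ (hf.norm measurableSet_Ici).nullMeasurableSet)
    (fun m n hmn ω hω ↦ le_trans (Nat.cast_le (α := ℝ).2 hmn) hω) ⟨0, measure_ne_top _ _⟩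
  have h0 : ⋂ n : ℕ, {ω | (n : ℝ) ≤ ‖f ω‖} = ∅ := by
    refine Set.eq_empty_of_forall_notMem fun ω hω ↦ ?_
    obtain ⟨n, hn⟩ := exists_nat_gt ‖f ω‖
    exact (Set.mem_iInter.1 hω n).not_gt hn
  rw [h0, measure_empty] at h
  obtain ⟨n, hn⟩ := (h.eventually_le_const hε).exists
  exact ⟨n, hn⟩

namespace IsAdditiveProcess

/-- Uniform tightness on `[0, T]`: a bound for one time `v` extends to a neighbourhood of `v` by
stochastic continuity, and compactness leaves finitely many bounds. -/
lemma exists_forall_le_measure_norm_sub_lt [IsProbabilityMeasure P]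
    (hX : IsAdditiveProcess X P) (T : ℝ≥0) :
    ∃ b : ℝ, ∀ u ≤ T, 2⁻¹ ≤ P {ω | ‖X T ω - X u ω‖ < b} := by
  have key : ∃ b : ℝ, ∀ u ∈ Set.Icc 0 T, P {ω | b ≤ ‖X T ω - X u ω‖} ≤ 2⁻¹ := by
    refine isCompact_Icc.induction_on (p := fun K ↦ ∃ b : ℝ, ∀ u ∈ K,
      P {ω | b ≤ ‖X T ω - X u ω‖} ≤ 2⁻¹) ⟨0, by simp⟩ ?_ ?_ ?_
    · rintro K K' hK ⟨b, hb⟩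
      exact ⟨b, fun u hu ↦ hb u (hK hu)⟩
    · rintro K K' ⟨b, hb⟩ ⟨b', hb'⟩
      refine ⟨max b b', fun u hu ↦ ?_⟩
      rcases hu with hu | hu
      · exact (measure_mono fun ω hω ↦ (le_max_left b b').trans hω).trans (hb u hu)
      · exact (measure_mono fun ω hω ↦ (le_max_right b b').trans hω).trans (hb' u hu)
    · intro v _
      have h4 : (0 : ℝ≥0∞) < 4⁻¹ := by simp
      obtain ⟨b, hb⟩ := exists_measure_le_norm_le (P := P)
        (f := fun ω ↦ X T ω - X v ω) ((hX.measurable T).sub (hX.measurable v)) h4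
      have hv := (tendstoInMeasure_iff_norm.1 (hX.stochasticallyContinuous v) 1
        one_pos).eventually_le_const h4
      refine ⟨_, mem_nhdsWithin_of_mem_nhds hv, b + 1, fun u hu ↦ ?_⟩
      calc P {ω | b + 1 ≤ ‖X T ω - X u ω‖}
          ≤ P ({ω | b ≤ ‖X T ω - X v ω‖} ∪ {ω | 1 ≤ ‖X u ω - X v ω‖}) := by
            refine measure_mono fun ω hω ↦ ?_
            by_contra! h
            simp only [Set.mem_union, not_or, Set.mem_ofPred_eq, not_le] at h hω
            have := norm_sub_le (X T ω - X v ω) (X u ω - X v ω)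
            rw [sub_sub_sub_cancel_right] at this
            linarith [h.1, h.2]
        _ ≤ 4⁻¹ + 4⁻¹ := (measure_union_le _ _).trans (add_le_add hb hu)
        _ = 2⁻¹ := by
            rw [← two_mul, show (4 : ℝ≥0∞) = 2 * 2 by norm_num,
              ENNReal.mul_inv (by simp) (by simp), ← mul_assoc,
              ENNReal.mul_inv_cancel (by simp) (by simp), one_mul]
  obtain ⟨b, hb⟩ := key
  refine ⟨b, fun u hu ↦ ?_⟩
  have hm : MeasurableSet {ω | b ≤ ‖X T ω - X u ω‖} :=
    ((hX.measurable T).sub (hX.measurable u)).norm measurableSet_Ici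
  have hc : {ω | ‖X T ω - X u ω‖ < b} = {ω | b ≤ ‖X T ω - X u ω‖}ᶜ := by
    ext ω
    simp
  rw [hc, prob_compl_eq_one_sub hm, ← ENNReal.one_sub_inv_two]
  exact tsub_le_tsub_left (hb u ⟨zero_le, hu⟩) _

lemma measure_exists_grid_norm_lt_le (hX : IsAdditiveProcess X P) {s l : ℝ≥0} {a b : ℝ}
    (hb : ∀ u, s ≤ u → u ≤ s + l → 2⁻¹ ≤ P {ω | ‖X (s + l) ω - X u ω‖ < b}) (k : ℕ) :
    P {ω | ∃ j : ℕ, j ≤ k + 1 ∧ ‖X (s + j * (l / (k + 1))) ω‖ < a} ≤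
      2 * P {ω | ‖X (s + l) ω‖ < a + b} := by
  -- The extra time 0 in front of the grid makes the partial sums equal to `X (τ n) - X 0`; hence
  -- the index set starts at 1.
  let τ : ℕ → ℝ≥0
    | 0 => 0
    | j + 1 => s + (min j (k + 1) : ℕ) * (l / (k + 1))
  have hτ : Monotone τ := by
    refine monotone_nat_of_le_succ fun n ↦ ?_
    cases n with
    | zero => exact zero_le
    | succ n =>
      dsimp only [τ]
      gcongr
      omega
  have hτN : τ (k + 2) = s + l := by
    have : ((k + 1 : ℕ) : ℝ≥0) ≠ 0 := by positivity
    simp only [τ, min_self]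
    push_cast at this ⊢
    rw [mul_div_cancel₀ _ this]
  have hsum : ∀ n ω, partialSum (fun i ω ↦ X (τ (i + 1)) ω - X (τ i) ω) n ω =
      X (τ n) ω - X 0 ω := fun n ω ↦ by
    simp only [partialSum]
    rw [Finset.sum_range_sub (fun i ↦ X (τ i) ω)]
  have hmax := measure_exists_partialSum_mem_ball_le (P := P)
    (ξ := fun i ω ↦ X (τ (i + 1)) ω - X (τ i) ω) (I := Set.Icc 1 (k + 2)) (N := k + 2)
    (a := a) (b := b)
    (fun i ↦ (hX.measurable _).sub (hX.measurable _)) (hX.indepIncrements.nat hτ)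
    (fun i hi ↦ hi.2) (fun i hi ↦ by
      simp_rw [hsum, sub_sub_sub_cancel_right, hτN]
      refine hb _ ?_ (hτN ▸ hτ hi.2)
      obtain ⟨j, rfl⟩ := Nat.exists_eq_add_of_le' hi.1
      exact le_self_add)
  simp_rw [hsum, hτN] at hmax
  refine le_trans (measure_mono_ae ?_) (hmax.trans ?_)
  · filter_upwards [hX.zero_ae] with ω hω
    rintro ⟨j, hj, hlt⟩
    refine ⟨j + 1, ⟨by omega, by omega⟩, ?_⟩
    simpa only [τ, min_eq_left hj, hω, sub_zero] using hlt
  · gcongr 2 * ?_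
    refine measure_mono_ae ?_
    filter_upwards [hX.zero_ae] with ω hω h
    change ‖X (s + l) ω - X 0 ω‖ < a + b at h
    rwa [hω, sub_zero] at h

/-- A maximal inequality on the interval `[s, s + l)`. -/
lemma measure_exists_norm_lt_le (hX : IsAdditiveProcess X P) {s l : ℝ≥0} {a b : ℝ}
    (hb : ∀ u, s ≤ u → u ≤ s + l → 2⁻¹ ≤ P {ω | ‖X (s + l) ω - X u ω‖ < b}) :
    P {ω | ∃ t, s ≤ t ∧ t < s + l ∧ ‖X t ω‖ < a} ≤ 2 * P {ω | ‖X (s + l) ω‖ < a + b} := by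
  set G : ℕ → Set Ω := fun k ↦ {ω | ∃ j : ℕ, j ≤ k + 1 ∧ ‖X (s + j * (l / (k + 1))) ω‖ < a}
  -- By right-continuity a visit at `t` lasts on some `[t, r)`, which every sufficiently fine grid
  -- meets.
  calc P {ω | ∃ t, s ≤ t ∧ t < s + l ∧ ‖X t ω‖ < a} ≤ P (⋃ K, ⋂ k ∈ Set.Ici K, G k) := by
        refine measure_mono_ae ?_
        filter_upwards [hX.rightContinuous] with ω hω
        rintro ⟨t, hst, htl, hta⟩
        have hev : ∀ᶠ u in 𝓝[≥] t, ‖X u ω‖ < a :=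
          (hω t).norm.eventually_lt_const hta
        obtain ⟨r, htr, hr⟩ := (mem_nhdsGE_iff_exists_Ico_subset (s := {u | ‖X u ω‖ < a})).1 hev
        have hl : 0 < l := by
          by_contra! h0
          rw [nonpos_iff_eq_zero.1 h0, add_zero] at htl
          exact htl.not_ge hst
        obtain ⟨K, hK⟩ := exists_nat_gt (l / (r - t))
        have hrt : 0 < r - t := tsub_pos_of_lt htr
        refine Set.mem_iUnion.2 ⟨K, Set.mem_iInter₂.2 fun k hk ↦ ?_⟩
        have hk1 : (0 : ℝ≥0) < k + 1 := by positivity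
        set δ := l / (k + 1 : ℝ≥0) with hδ
        have hδ0 : 0 < δ := div_pos hl hk1
        have hδr : δ < r - t := by
          rw [div_lt_iff₀ hrt] at hK
          rw [hδ, div_lt_iff₀ hk1, mul_comm]
          refine hK.trans_le ?_
          gcongr
          exact (Nat.cast_le.2 hk).trans le_self_add
        have hceil := Nat.ceil_lt_add_one (a := (t - s) / δ) zero_le
        have hceil' := Nat.le_ceil ((t - s) / δ)
        rw [div_le_iff₀ hδ0] at hceil'
        -- The first grid point at or after `t`; it precedes `t + δ`, hence `r`.
        refine ⟨⌈(t - s) / δ⌉₊, ?_, hr ⟨?_, ?_⟩⟩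
        · rw [Nat.ceil_le, div_le_iff₀ hδ0, hδ]
          push_cast
          rw [mul_div_cancel₀ _ hk1.ne']
          exact tsub_le_iff_left.2 htl.le
        · exact tsub_le_iff_left.1 hceil'
        · calc s + ⌈(t - s) / δ⌉₊ * δ < s + ((t - s) / δ + 1) * δ := by gcongr
            _ = t + δ := by
              rw [add_one_mul, div_mul_cancel₀ _ hδ0.ne', ← add_assoc, add_tsub_cancel_of_le hst]
            _ < r := lt_tsub_iff_left.1 hδr
    _ = ⨆ K, P (⋂ k ∈ Set.Ici K, G k) := by
        refine Monotone.measure_iUnion fun m n hmn ↦ ?_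
        exact Set.biInter_subset_biInter_left (Set.Ici_subset_Ici.2 hmn)
    _ ≤ _ := iSup_le fun K ↦ (measure_mono (Set.biInter_subset_of_mem Set.self_mem_Ici)).trans
        (hX.measure_exists_grid_norm_lt_le hb K)

end IsAdditiveProcess

namespace IsSemiLevyProcess

/-- By periodicity the `b` found on `[0, p]` serves every period and every radius. -/
lemma exists_forall_measure_exists_norm_lt_le [IsProbabilityMeasure P]
    (hX : IsSemiLevyProcess X p P) :
    ∃ b : ℝ, ∀ (a : ℝ) (n : ℕ), P {ω | ∃ t, n * p ≤ t ∧ t < n * p + p ∧ ‖X t ω‖ < a} ≤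
      2 * P {ω | ‖X ((n + 1 : ℕ) * p) ω‖ < a + b} := by
  obtain ⟨b, hb⟩ := hX.exists_forall_le_measure_norm_sub_lt p
  refine ⟨b, fun a n ↦ ?_⟩
  have e : ((n + 1 : ℕ) : ℝ≥0) * p = n * p + p := by push_cast; ring
  rw [e]
  refine hX.measure_exists_norm_lt_le fun u hu hu' ↦ ?_
  obtain ⟨v, rfl⟩ := exists_add_of_le hu
  refine (hb v (le_of_add_le_add_left hu')).trans_eq ?_
  have := (hX.identDistrib_shift_nat n v p).measure_mem_eq
    (s := {x | ‖x‖ < b}) (measurable_norm measurableSet_Iio)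
  rw [add_comm (n * p), add_comm (n * p)]
  exact this.symm

lemma exists_tsum_measure_exists_norm_lt_le [IsProbabilityMeasure P]
    (hX : IsSemiLevyProcess X p P) :
    ∃ b : ℝ, ∀ a : ℝ, ∑' n : ℕ, P {ω | ∃ t, n * p ≤ t ∧ t < n * p + p ∧ ‖X t ω‖ < a} ≤
      2 * skeletonPotential X p P (a + b) := by
  obtain ⟨b, hb⟩ := hX.exists_forall_measure_exists_norm_lt_le
  refine ⟨b, fun a ↦ (ENNReal.tsum_le_tsum (hb a)).trans ?_⟩
  rw [ENNReal.tsum_mul_left]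
  gcongr
  exact ENNReal.tsum_comp_le_tsum_of_injective (add_left_injective 1)
    fun n : ℕ ↦ P {ω | ‖X (n * p) ω‖ < a + b}

lemma isTransient_of_skeletonPotential_lt_top [IsProbabilityMeasure P]
    (hX : IsSemiLevyProcess X p P) (h : ∀ a : ℝ, skeletonPotential X p P a < ∞) :
    IsTransient X P := by
  obtain ⟨b, hb⟩ := hX.exists_tsum_measure_exists_norm_lt_le
  have key : ∀ a : ℕ, ∀ᵐ ω ∂P, ∀ᶠ n : ℕ in atTop,
      ω ∉ {ω | ∃ t, n * p ≤ t ∧ t < n * p + p ∧ ‖X t ω‖ < a} := fun a ↦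
    ae_eventually_notMem ((hb a).trans_lt (ENNReal.mul_lt_top (by simp) (h _))).ne
  filter_upwards [ae_all_iff.2 key] with ω hω
  refine tendsto_atTop.2 fun c ↦ ?_
  obtain ⟨a, ha⟩ := exists_nat_ge c
  obtain ⟨N, hN⟩ := eventually_atTop.1 (hω a)
  filter_upwards [eventually_ge_atTop (N * p)] with t ht
  -- `⌊t / p⌋₊` is the index of the period containing `t`.
  refine ha.trans (not_lt.1 fun hlt ↦ hN ⌊t / p⌋₊ ?_ ⟨t, ?_, ?_, hlt⟩)
  · exact Nat.le_floor ((le_div_iff₀ hX.period_pos).2 ht)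
  · exact (le_div_iff₀ hX.period_pos).1 (Nat.floor_le zero_le)
  · rw [← add_one_mul]
    exact (div_lt_iff₀ hX.period_pos).1 (Nat.lt_floor_add_one _)

end IsSemiLevyProcess

end Transience

/-! ### Joint measurability and occupation times. -/

section Occupation

variable {Ω : Type*} [MeasurableSpace Ω] {P : Measure Ω} {d : ℕ}
  {X : ℝ≥0 → Ω → EuclideanSpace ℝ (Fin d)} {p : ℝ≥0}

lemma measurable_eval_countable (hX : ∀ t, Measurable (X t)) {φ : ℝ≥0 → ℕ} (a : ℕ → ℝ≥0)
    (hφ : Measurable φ) : Measurable fun z : ℝ≥0 × Ω ↦ X (a (φ z.1)) z.2 := by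
  have h1 : Measurable fun z : ℕ × Ω ↦ X (a z.1) z.2 :=
    measurable_from_prod_countable_right fun n ↦ hX (a n)
  have h2 : Measurable fun z : ℝ≥0 × Ω ↦ (φ z.1, z.2) :=
    (hφ.comp measurable_fst).prodMk measurable_snd
  exact h1.comp h2

/-- Times rounded up to the grid of mesh `1 / (k + 1)`: the process at countably many times is
jointly measurable, and right-continuous paths pass to the limit. -/
lemma exists_countable_approx_from_right : ∃ (φ : ℕ → ℝ≥0 → ℕ) (a : ℕ → ℕ → ℝ≥0),
    (∀ k, Measurable (φ k)) ∧ ∀ t, Tendsto (fun k ↦ a k (φ k t)) atTop (𝓝[≥] t) := by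
  refine ⟨fun k t ↦ ⌊t * (k + 1)⌋₊, fun k n ↦ ((n : ℝ≥0) + 1) / (k + 1),
    fun k ↦ Nat.measurable_floor.comp (measurable_id.mul_const _), fun t ↦ ?_⟩
  have hpos : ∀ k : ℕ, (0 : ℝ≥0) < k + 1 := fun k ↦ by positivity
  have hle : ∀ k : ℕ, t ≤ ((⌊t * (k + 1)⌋₊ : ℝ≥0) + 1) / (k + 1) := fun k ↦ by
    rw [le_div_iff₀ (hpos k)]
    exact (Nat.lt_floor_add_one _).le
  refine tendsto_nhdsWithin_of_tendsto_nhds_of_eventually_within _ ?_ (.of_forall hle)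
  have hup : Tendsto (fun k : ℕ ↦ t + 1 / ((k : ℝ≥0) + 1)) atTop (𝓝 t) := by
    simpa using tendsto_const_nhds.add (tendsto_one_div_add_atTop_nhds_zero_nat (𝕜 := ℝ≥0))
  refine tendsto_of_tendsto_of_tendsto_of_le_of_le tendsto_const_nhds hup hle fun k ↦ ?_
  dsimp only
  rw [add_div]
  gcongr
  rw [div_le_iff₀ (hpos k)]
  exact Nat.floor_le zero_le

/-- A right-continuous process is indistinguishable from a jointly measurable one. -/
lemma IsAdditiveProcess.exists_measurable_modification (hX : IsAdditiveProcess X P) :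
    ∃ Y : ℝ≥0 → Ω → EuclideanSpace ℝ (Fin d), Measurable (Function.uncurry Y) ∧
      ∀ᵐ ω ∂P, ∀ t, Y t ω = X t ω := by
  classical
  obtain ⟨N, hN, hNm, hN0⟩ := exists_measurable_superset_of_null (ae_iff.1 hX.rightContinuous)
  obtain ⟨φ, a, hφ, ha⟩ := exists_countable_approx_from_right
  -- Setting the path to 0 on a measurable null set containing the bad paths makes the
  -- approximations converge everywhere.
  refine ⟨fun t ω ↦ if ω ∈ N then 0 else X t ω, ?_, ?_⟩
  · refine measurable_of_tendsto_metrizable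
      (f := fun k z ↦ if z.2 ∈ N then 0 else X (a k (φ k z.1)) z.2)
      (fun k ↦ Measurable.ite (p := fun z : ℝ≥0 × Ω ↦ z.2 ∈ N) (measurable_snd hNm)
        measurable_const
        (measurable_eval_countable hX.measurable (a k) (hφ k))) ?_
    refine tendsto_pi_nhds.2 fun z ↦ ?_
    by_cases hz : z.2 ∈ N
    · simp [Function.uncurry, hz]
    · have hc : ∀ t, ContinuousWithinAt (fun u ↦ X u z.2) (Set.Ici t) t := by
        by_contra h
        exact hz (hN h)
      simpa [Function.uncurry, hz, Function.comp_def] using (hc z.1).tendsto.comp (ha z.1)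
  · have : ∀ᵐ ω ∂P, ω ∉ N := measure_eq_zero_iff_ae_notMem.1 hN0
    filter_upwards [this] with ω hω t
    simp [hω]

lemma lintegral_Ici_eq_lintegral_tsum {f : ℝ → ℝ≥0∞} (hf : Measurable f) {q : ℝ} (hq : 0 < q) :
    ∫⁻ t in Set.Ici 0, f t = ∫⁻ u in Set.Ico 0 q, ∑' n : ℕ, f (u + n * q) := by
  have hU : Set.Ici (0 : ℝ) = ⋃ n : ℕ, Set.Ico (n * q) (n * q + q) := by
    ext t
    simp only [Set.mem_Ici, Set.mem_iUnion, Set.mem_Ico]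
    constructor
    · intro ht
      refine ⟨⌊t / q⌋₊, ?_, ?_⟩
      · exact (le_div_iff₀ hq).1 (Nat.floor_le (by positivity))
      · rw [← add_one_mul]
        exact (div_lt_iff₀ hq).1 (Nat.lt_floor_add_one _)
    · rintro ⟨n, hn, -⟩
      exact le_trans (by positivity) hn
  have hdisj : Pairwise (Function.onFun Disjoint fun n : ℕ ↦ Set.Ico (n * q) (n * q + q)) := by
    refine (pairwise_disjoint_on _).2 fun m n hmn ↦ Set.disjoint_left.2 fun t h h' ↦ ?_
    have : ((m : ℝ) + 1) * q ≤ n * q := by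
      gcongr
      exact_mod_cast hmn
    have h1 := h.2
    have h2 := h'.1
    linarith
  rw [hU, lintegral_iUnion (fun n ↦ measurableSet_Ico) hdisj,
    lintegral_tsum (f := fun (n : ℕ) u ↦ f (u + n * q))
      fun n ↦ (hf.comp (measurable_add_const _)).aemeasurable]
  refine tsum_congr fun n ↦ ?_
  have h := (measurePreserving_add_right volume ((n : ℝ) * q)).setLIntegral_comp_preimage
    (s := Set.Ico (n * q) (n * q + q)) measurableSet_Ico hf
  rw [← h]
  congr 2
  ext u
  simp

namespace IsAdditiveProcess

lemma potential_eq_lintegral_occupationTime [SFinite P] (hX : IsAdditiveProcess X P) (a : ℝ) :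
    potential X P a = ∫⁻ ω, occupationTime X a ω ∂P := by
  obtain ⟨Y, hY, hYX⟩ := hX.exists_measurable_modification
  have hm : Measurable fun z : ℝ × Ω ↦
      (Metric.ball (0 : EuclideanSpace ℝ (Fin d)) a).indicator (fun _ ↦ (1 : ℝ≥0∞))
        (Y z.1.toNNReal z.2) :=
    (measurable_const.indicator measurableSet_ball).comp
      (hY.comp (measurable_fst.real_toNNReal.prodMk measurable_snd))
  calc potential X P a
      = ∫⁻ t in Set.Ici (0 : ℝ), ∫⁻ ω, (Metric.ball (0 : EuclideanSpace ℝ (Fin d)) a).indicator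
          (fun _ ↦ 1) (Y t.toNNReal ω) ∂P := by
        refine lintegral_congr fun t ↦ ?_
        have hm := hX.measurable t.toNNReal
          (measurableSet_ball (x := (0 : EuclideanSpace ℝ (Fin d))) (ε := a))
        refine (lintegral_indicator_one hm).symm.trans ?_
        refine lintegral_congr_ae ?_
        filter_upwards [hYX] with ω hω
        rw [hω]
        rfl
    _ = ∫⁻ ω, (∫⁻ t in Set.Ici (0 : ℝ), (Metric.ball (0 : EuclideanSpace ℝ (Fin d)) a).indicator
          (fun _ ↦ 1) (Y t.toNNReal ω)) ∂P := lintegral_lintegral_swap hm.aemeasurable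
    _ = _ := by
        refine lintegral_congr_ae ?_
        filter_upwards [hYX] with ω hω
        simp only [hω, occupationTime]

lemma measurable_measure_norm_lt [SFinite P] (hX : IsAdditiveProcess X P) (a : ℝ) :
    Measurable fun t : ℝ ↦ P {ω | ‖X t.toNNReal ω‖ < a} := by
  obtain ⟨Y, hY, hYX⟩ := hX.exists_measurable_modification
  have hS : MeasurableSet {z : ℝ × Ω | ‖Y z.1.toNNReal z.2‖ < a} :=
    (hY.comp (measurable_fst.real_toNNReal.prodMk measurable_snd)).norm measurableSet_Iio
  convert measurable_measure_prodMk_left (ν := P) hS using 2 with t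
  refine measure_congr ?_
  filter_upwards [hYX] with ω hω
  change (‖X t.toNNReal ω‖ < a) = (‖Y t.toNNReal ω‖ < a)
  rw [hω]

end IsAdditiveProcess

namespace IsSemiLevyProcess

/-- The skeleton from `u` comes within `a - ‖X u ω‖` of `X u ω` at arbitrarily late times, and each
such visit lies in `B_a`. A finite sum of 0-1 terms would have terms tending to 0. -/
lemma ae_tsum_indicator_eq_top [IsProbabilityMeasure P] (hX : IsSemiLevyProcess X p P)
    (h : ∀ a : ℝ, 0 < a → skeletonPotential X p P a = ∞) (a : ℝ) (u : ℝ≥0) :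
    ∀ᵐ ω ∂P, ‖X u ω‖ < a → ∑' n : ℕ, (Metric.ball (0 : EuclideanSpace ℝ (Fin d)) a).indicator
      (fun _ ↦ (1 : ℝ≥0∞)) (X (u + n * p) ω) = ∞ := by
  filter_upwards [hX.ae_forall_exists_norm_sub_lt h u] with ω hω ha
  by_contra hne
  have h0 := ENNReal.tendsto_atTop_zero_of_tsum_ne_top hne
  obtain ⟨N, hN⟩ := eventually_atTop.1 (h0.eventually_lt_const one_pos)
  obtain ⟨n, hn, hlt⟩ := hω N (a - ‖X u ω‖) (sub_pos.2 ha)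
  have hmem : X (u + n * p) ω ∈ Metric.ball (0 : EuclideanSpace ℝ (Fin d)) a := by
    have := norm_add_le (X (u + n * p) ω - X u ω) (X u ω)
    rw [sub_add_cancel] at this
    rw [mem_ball_zero_iff]
    linarith
  have := hN n hn
  rw [Set.indicator_of_mem hmem] at this
  exact lt_irrefl _ this

lemma ae_occupationTime_eq_top [IsProbabilityMeasure P] (hX : IsSemiLevyProcess X p P)
    (h : ∀ a : ℝ, 0 < a → skeletonPotential X p P a = ∞) {a : ℝ} (ha : 0 < a) :
    ∀ᵐ ω ∂P, occupationTime X a ω = ∞ := by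
  obtain ⟨Y, hY, hYX⟩ := hX.exists_measurable_modification
  set φ : EuclideanSpace ℝ (Fin d) → ℝ≥0∞ :=
    (Metric.ball (0 : EuclideanSpace ℝ (Fin d)) a).indicator (fun _ ↦ 1) with hφ
  have hφm : Measurable φ := measurable_const.indicator measurableSet_ball
  have hp : (0 : ℝ) < p := hX.period_pos
  have hS : MeasurableSet {z : ℝ × Ω | ‖Y z.1.toNNReal z.2‖ < a →
      ∑' n : ℕ, φ (Y (z.1.toNNReal + n * p) z.2) = ∞} := by
    have h1 : MeasurableSet {z : ℝ × Ω | ‖Y z.1.toNNReal z.2‖ < a} :=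
      (hY.comp (measurable_fst.real_toNNReal.prodMk measurable_snd)).norm measurableSet_Iio
    have h2 : Measurable fun z : ℝ × Ω ↦ ∑' n : ℕ, φ (Y (z.1.toNNReal + n * p) z.2) :=
      Measurable.tsum fun n ↦ hφm.comp
        (hY.comp ((measurable_fst.real_toNNReal.add_const _).prodMk measurable_snd))
    have := h1.compl.union (h2 (measurableSet_singleton ∞))
    convert this using 1
    ext z
    simp [imp_iff_not_or]
  -- The exceptional null set depends on `u`; Fubini gives almost every path the property for almost
  -- every `u`.
  have key : ∀ᵐ ω ∂P, ∀ᵐ u : ℝ, ‖Y u.toNNReal ω‖ < a →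
      ∑' n : ℕ, φ (Y (u.toNNReal + n * p) ω) = ∞ := by
    refine (Measure.ae_ae_comm hS).1 (.of_forall fun u ↦ ?_)
    filter_upwards [hYX, hX.ae_tsum_indicator_eq_top h a u.toNNReal] with ω h1 h2
    simpa only [h1] using h2
  filter_upwards [key, hYX, hX.zero_ae, hX.rightContinuous] with ω h1 h2 h3 h4
  simp only [h2] at h1
  have hXm : Measurable fun t : ℝ ↦ φ (X t.toNNReal ω) := by
    have : Measurable fun t : ℝ ↦ φ (Y t.toNNReal ω) :=
      hφm.comp (hY.comp (measurable_real_toNNReal.prodMk measurable_const))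
    simpa only [h2] using this
  have hev : ∀ᶠ u in 𝓝[≥] (0 : ℝ≥0), ‖X u ω‖ < a :=
    (h4 0).norm.eventually_lt_const (by simpa [h3] using ha)
  obtain ⟨r, hr0, hr⟩ := (mem_nhdsGE_iff_exists_Ico_subset (s := {u | ‖X u ω‖ < a})).1 hev
  -- On `[0, min r p)` the path is still in `B_a` and within the first period, so the folded
  -- integrand is almost everywhere infinite on a set of positive length.
  have hε : (0 : ℝ) < min (r : ℝ) p := lt_min hr0 hp
  refine top_le_iff.1 ?_
  calc ∞ = ∫⁻ _u in Set.Ico (0 : ℝ) (min (r : ℝ) p), ∞ := by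
        rw [setLIntegral_const, Real.volume_Ico, ENNReal.top_mul]
        simpa [pos_iff_ne_zero] using hε
    _ ≤ ∫⁻ u in Set.Ico (0 : ℝ) (min (r : ℝ) p), ∑' n : ℕ, φ (X (u + n * p).toNNReal ω) := by
        refine setLIntegral_mono_ae' measurableSet_Ico ?_
        filter_upwards [h1] with u hu hmem
        have hur : u.toNNReal < r :=
          (Real.toNNReal_lt_iff_lt_coe hmem.1).2 (hmem.2.trans_le (min_le_left _ _))
        rw [← hu (hr ⟨zero_le, hur⟩)]
        refine (tsum_congr fun n ↦ ?_).le
        rw [Real.toNNReal_add hmem.1 (by positivity), Real.toNNReal_mul (by positivity)]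
        simp
    _ ≤ ∫⁻ u in Set.Ico (0 : ℝ) p, ∑' n : ℕ, φ (X (u + n * p).toNNReal ω) :=
        lintegral_mono_set (Set.Ico_subset_Ico_right (min_le_right _ _))
    _ = occupationTime X a ω := (lintegral_Ici_eq_lintegral_tsum hXm hp).symm

lemma potential_eq_top [IsProbabilityMeasure P] (hX : IsSemiLevyProcess X p P)
    (h : ∀ a : ℝ, 0 < a → skeletonPotential X p P a = ∞) {a : ℝ} (ha : 0 < a) :
    potential X P a = ∞ := by
  rw [hX.potential_eq_lintegral_occupationTime,
    lintegral_congr_ae (hX.ae_occupationTime_eq_top h ha)]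
  simp

end IsSemiLevyProcess

lemma IsTransient.ae_occupationTime_lt_top (h : IsTransient X P) (a : ℝ) :
    ∀ᵐ ω ∂P, occupationTime X a ω < ∞ := by
  filter_upwards [h] with ω hω
  obtain ⟨T, hT⟩ := eventually_atTop.1 (hω.eventually_ge_atTop a)
  have hle : occupationTime X a ω ≤
      ∫⁻ t in Set.Ici (0 : ℝ), (Set.Ico 0 (T : ℝ)).indicator (fun _ ↦ 1) t := by
    refine setLIntegral_mono' measurableSet_Ici fun t ht ↦ ?_
    by_cases htT : t < T
    · rw [Set.indicator_of_mem (s := Set.Ico 0 (T : ℝ)) ⟨ht, htT⟩]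
      exact Set.indicator_le_self' (fun _ _ ↦ zero_le) _
    · rw [Set.indicator_of_notMem]
      · exact zero_le
      · have := hT t.toNNReal (NNReal.le_toNNReal_of_coe_le (not_lt.1 htT))
        simpa using this
  refine hle.trans_lt ((setLIntegral_le_lintegral _ _).trans_lt ?_)
  rw [lintegral_indicator measurableSet_Ico]
  simp

end Occupation

/-! ### The dichotomy, discretisation, and the theorem. -/

section Main

variable {Ω : Type*} [MeasurableSpace Ω] {P : Measure Ω} {d : ℕ}
  {X : ℝ≥0 → Ω → EuclideanSpace ℝ (Fin d)} {p : ℝ≥0}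

namespace IsSemiLevyProcess

/-- Fold the time integral onto `[0, p)`; being in `B_a` at `u + n * p` implies a visit during
period `n`, so the summed visit bound holds uniformly in `u`. -/
lemma potential_lt_top [IsProbabilityMeasure P] (hX : IsSemiLevyProcess X p P)
    (h : ∀ a : ℝ, skeletonPotential X p P a < ∞) (a : ℝ) : potential X P a < ∞ := by
  obtain ⟨b, hb⟩ := hX.exists_tsum_measure_exists_norm_lt_le
  have hp : (0 : ℝ) < p := hX.period_pos
  calc potential X P a = ∫⁻ t in Set.Ici (0 : ℝ), P {ω | ‖X t.toNNReal ω‖ < a} := by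
        simp only [potential, mem_ball_zero_iff]
    _ = ∫⁻ u in Set.Ico (0 : ℝ) p, ∑' n : ℕ, P {ω | ‖X (u + n * p).toNNReal ω‖ < a} :=
        lintegral_Ici_eq_lintegral_tsum (hX.measurable_measure_norm_lt a) hp
    _ ≤ ∫⁻ _u in Set.Ico (0 : ℝ) p, 2 * skeletonPotential X p P (a + b) := by
        refine setLIntegral_mono' measurableSet_Ico fun u hu ↦ le_trans ?_ (hb a)
        refine ENNReal.tsum_le_tsum fun n ↦ measure_mono fun ω hω ↦ ?_
        have e : (u + n * p).toNNReal = n * p + u.toNNReal := by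
          rw [Real.toNNReal_add hu.1 (by positivity), Real.toNNReal_mul (by positivity), add_comm]
          simp
        rw [e] at hω
        refine ⟨n * p + u.toNNReal, le_self_add, ?_, hω⟩
        gcongr
        exact (Real.toNNReal_lt_iff_lt_coe hu.1).2 hu.2
    _ < ∞ := by
        rw [setLIntegral_const, Real.volume_Ico]
        exact ENNReal.mul_lt_top (ENNReal.mul_lt_top (by simp) (h _)) (by simp)

/-- The dichotomy between recurrence and transience, with all of its quantitative forms. -/
lemma recurrent_or_transient [IsProbabilityMeasure P] (hX : IsSemiLevyProcess X p P) :
    (IsRecurrent X P ∧ (∀ a : ℝ, 0 < a → potential X P a = ∞) ∧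
        ∀ a : ℝ, 0 < a → ∀ᵐ ω ∂P, occupationTime X a ω = ∞) ∨
      (IsTransient X P ∧ (∀ a : ℝ, potential X P a < ∞) ∧
        ∀ a : ℝ, ∀ᵐ ω ∂P, occupationTime X a ω < ∞) := by
  refine hX.skeletonPotential_eq_top_or_lt_top.imp (fun h ↦ ?_) (fun h ↦ ?_)
  · exact ⟨hX.isRecurrent_of_skeletonPotential_eq_top h, fun a ha ↦ hX.potential_eq_top h ha,
      fun a ha ↦ hX.ae_occupationTime_eq_top h ha⟩
  · have ht := hX.isTransient_of_skeletonPotential_lt_top h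
    exact ⟨ht, hX.potential_lt_top h, ht.ae_occupationTime_lt_top⟩

lemma isSemiRandomWalk (hX : IsSemiLevyProcess X p P) {h : ℝ≥0} {k m : ℕ} (hk : 0 < k)
    (hkm : k * h = m * p) : IsSemiRandomWalk (fun n : ℕ ↦ X (n * h)) k P where
  measurable n := hX.measurable _
  period_pos := hk
  zero_ae := by simpa using hX.zero_ae
  indepIncrements n t ht := hX.indepIncrements n (fun i ↦ t i * h) fun i j hij ↦ by
    dsimp only
    gcongr
    exact ht hij
  identDistrib_shift i j := by
    have e : ∀ n : ℕ, ((n + k : ℕ) : ℝ≥0) * h = n * h + m * p := fun n ↦ by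
      push_cast
      rw [add_mul, hkm]
    simp_rw [e]
    exact hX.identDistrib_shift_nat m _ _

lemma isRecurrent_of_isRecurrentFrom_zero [IsProbabilityMeasure P]
    (hX : IsSemiLevyProcess X p P) (h : IsRecurrentFrom 0 X P) : IsRecurrent X P := by
  obtain h' | h' := hX.recurrent_or_transient
  · exact h'.1
  · exact (hX.not_isRecurrentFrom_zero_and_isTransient ⟨h, h'.1⟩).elim

/-- Forward, recurrence excludes finite potentials for the period `m * p`, and the corresponding
skeleton from `j * h` runs through the times `(j + n * k) * h` of the walk. Backward, 0-recurrence
along `n * h` already gives 0-recurrence of `X`. -/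
lemma isRecurrent_iff_isRecurrent_nat_mul [IsProbabilityMeasure P]
    (hX : IsSemiLevyProcess X p P) {h : ℝ≥0} (hh : 0 < h) {k m : ℕ} (hk : 0 < k) (hm : 0 < m)
    (hkm : k * h = m * p) : IsRecurrent X P ↔ IsRecurrent (fun n : ℕ ↦ X (n * h)) P := by
  constructor
  · intro hr j
    have hX' := hX.nat_mul hm
    obtain htop | hfin := hX'.skeletonPotential_eq_top_or_lt_top
    · filter_upwards [hX'.ae_forall_exists_norm_sub_lt htop (j * h)] with ω hω
      refine liminf_enorm_eq_zero_of_subseq (x := fun n : ℕ ↦ X (n * h) ω - X (j * h) ω)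
        (u := fun n ↦ j + n * k)
        (tendsto_atTop_mono (fun n ↦ (Nat.le_mul_of_pos_right n hk).trans le_add_self)
          tendsto_id) fun N ε hε ↦ ?_
      obtain ⟨n, hn, hlt⟩ := hω N ε hε
      refine ⟨n, hn, ?_⟩
      have e : ((j + n * k : ℕ) : ℝ≥0) * h = j * h + n * (m * p) := by
        push_cast
        rw [← hkm]
        ring
      rwa [e]
    · exact (hX.not_isRecurrentFrom_zero_and_isTransient
        ⟨hr 0, hX'.isTransient_of_skeletonPotential_lt_top hfin⟩).elim
  · intro hr
    refine hX.isRecurrent_of_isRecurrentFrom_zero ?_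
    filter_upwards [hr 0] with ω hω
    refine liminf_enorm_eq_zero_of_comp (x := fun t ↦ X t ω - X 0 ω)
      (u := fun n : ℕ ↦ (n : ℝ≥0) * h)
      (tendsto_natCast_atTop_atTop.atTop_mul_const hh) ?_
    simpa using hω

end IsSemiLevyProcess

end Main

theorem theorem1p1 {Ω : Type*} [MeasurableSpace Ω] (P : Measure Ω) [IsProbabilityMeasure P]
    {d : ℕ} (X : ℝ≥0 → Ω → EuclideanSpace ℝ (Fin d)) (p : ℝ≥0)
    (hX : IsSemiLevyProcess X p P) :
    (IsRecurrentFrom 0 X P → IsRecurrent X P) ∧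
    ((IsRecurrent X P ∨ IsTransient X P) ∧ ¬ (IsRecurrent X P ∧ IsTransient X P)) ∧
    (IsRecurrent X P ↔ ∀ a : ℝ, 0 < a → potential X P a = ∞) ∧
    (IsRecurrent X P ↔ ∀ a : ℝ, 0 < a → ∀ᵐ ω ∂P, occupationTime X a ω = ∞) ∧
    (IsTransient X P ↔ ∀ a : ℝ, 0 < a → potential X P a < ∞) ∧
    (IsTransient X P ↔ ∀ a : ℝ, 0 < a → ∀ᵐ ω ∂P, occupationTime X a ω < ∞) ∧
    (∀ h : ℝ≥0, 0 < h → (∃ q : ℚ, (h : ℝ) = p * q) →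
      (∃ k : ℕ, IsSemiRandomWalk (fun n : ℕ ↦ X (n * h)) k P) ∧
      (IsRecurrent X P ↔ IsRecurrent (fun n : ℕ ↦ X (n * h)) P)) := by
  have excl := hX.not_isRecurrentFrom_zero_and_isTransient
  have rt : ¬ (IsRecurrent X P ∧ IsTransient X P) := fun h ↦ excl ⟨h.1 0, h.2⟩
  refine ⟨hX.isRecurrent_of_isRecurrentFrom_zero,
    ⟨hX.recurrent_or_transient.imp And.left And.left, rt⟩, ?_, ?_, ?_, ?_, ?_⟩
  · obtain ⟨h, hpot, -⟩ | ⟨h, hpot, -⟩ := hX.recurrent_or_transient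
    · exact iff_of_true h hpot
    · exact iff_of_false (fun h' ↦ rt ⟨h', h⟩) fun h' ↦ (hpot 1).ne (h' 1 one_pos)
  · obtain ⟨h, -, hocc⟩ | ⟨h, -, hocc⟩ := hX.recurrent_or_transient
    · exact iff_of_true h hocc
    · refine iff_of_false (fun h' ↦ rt ⟨h', h⟩) fun h' ↦ ?_
      obtain ⟨ω, h1, h2⟩ := ((hocc 1).and (h' 1 one_pos)).exists
      exact h1.ne h2
  · obtain ⟨h, hpot, -⟩ | ⟨h, hpot, -⟩ := hX.recurrent_or_transient
    · exact iff_of_false (fun h' ↦ rt ⟨h, h'⟩) fun h' ↦ (h' 1 one_pos).ne (hpot 1 one_pos)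
    · exact iff_of_true h fun a _ ↦ hpot a
  · obtain ⟨h, -, hocc⟩ | ⟨h, -, hocc⟩ := hX.recurrent_or_transient
    · refine iff_of_false (fun h' ↦ rt ⟨h, h'⟩) fun h' ↦ ?_
      obtain ⟨ω, h1, h2⟩ := ((h' 1 one_pos).and (hocc 1 one_pos)).exists
      exact h1.ne h2
    · exact iff_of_true h fun a _ ↦ hocc a
  · rintro h hh ⟨q, hq⟩
    have hp : (0 : ℝ) < p := hX.period_pos
    have hh' : (0 : ℝ) < h := hh
    have hq0 : 0 < q := by
      rw [hq] at hh'
      exact_mod_cast pos_of_mul_pos_right hh' hp.le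
    have hnum : 0 < q.num := Rat.num_pos.2 hq0
    obtain ⟨m, hm⟩ := Int.eq_ofNat_of_zero_le hnum.le
    -- With `q = m / k` in lowest terms, `k = q.den` steps of length `h` make exactly `m` periods.
    have hkm : (q.den : ℝ≥0) * h = m * p := by
      refine NNReal.coe_injective ?_
      push_cast
      have h1 : (q : ℝ) * q.den = m := by
        have := Rat.mul_den_eq_num q
        rw [hm] at this
        exact_mod_cast this
      rw [hq, ← h1]
      ring
    have hm0 : 0 < m := by omega
    exact ⟨⟨q.den, hX.isSemiRandomWalk q.den_pos hkm⟩,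
      hX.isRecurrent_iff_isRecurrent_nat_mul hh q.den_pos hm0 hkm⟩
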